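/- **Setting.** An abstract state space $(A,\Omega,u)$ consists of a finite-dimensional real vector space $A$, a convex compact set $\Omega\subset A$ of (normalized) states such that $A_+:=\mathbb R_{\ge 0}\cdot\Omega$ is a closed, pointed (nonempty) convex cone that spans $A$, and a linear functional $u:A\to\mathbb R$ that is strictly positive on $A_+\setminus\{0\}$ and such that an $x\in A_+$ lies in $\Omega$ if and only if $u(x)=1$. An effect is a linear functional $e$ with $0\le e\le u$ on $A_+$. A transformation is a linear map $T:A\to A$ with $T(A_+)\subset A_+$ and $u\circ T\le u$ on $A_+$. The theory also specifies a convex set $\mathcal E$ of allowed effects spanning $A^*$, closed under $e\mapsto u-e$ and under those sums $e+f$ that are effects, and a group $\mathcal G$ of invertible transformations (the reversible transformations; their inverses are transformations, too) with $e\circ T\in\mathcal E$ for $e\in\mathcal E$, $T\in\mathcal G$. A finite family $w_1,\dots,w_n$ of states is perfectly distinguishable if there are $e_1,\dots,e_n\in\mathcal E$ with $\sum_j e_j\le u$ on $A_+$ and $e_j(w_k)=\delta_{jk}$. A frame is a finite perfectly distinguishable family of pure states (extreme points of $\Omega$); it is maximal if it is not part of a strictly larger frame. A classical decomposition of a state $w$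 is an expression $w=\sum_j p_jw_j$ with $(p_j)$ a probability distribution and $(w_j)$ a frame. The face of $A_+$ generated by a set $M\subset A_+$ is the intersection of all faces of $A_+$ that contain $M$. *Postulate 1 (classical decomposability).* Every state has a classical decomposition. *Postulate 2 (strong symmetry).* For any two frames $w_1,\dots,w_n$ and $v_1,\dots,v_n$ of the same size there is a $T\in\mathcal G$ with $Tw_j=v_j$ for all $j$. **Theorem.** Assume Postulates 1 and 2. 1. Let $\mathcal A=\sum_{x=1}^{n_a}a_x\sum_{j}w_{j,a,x}=\sum_{x=1}^{n_b}b_x\sum_{j}w_{j,b,x}$ be two decompositions of an element $\mathcal A\in A$, where the $a_x\in\mathbb R$ are pairwise distinct, the $b_x\in\mathbb R$ are pairwise distinct, every inner sum is nonempty, and all the $w_{j,a,x}$ together, as well as all the $w_{j,b,x}$ together, form a maximal frame. Then $n_a=n_b$ and there is a permutation $\sigma$ such that, for every $x$, $b_{\sigma(x)}=a_x$, $\sum_j w_{j,b,\sigma(x)}=\sum_j w_{j,a,x}=:u_x$, both sums have the same number of terms, and the eigenfaces, i.e. the faces of $A_+$ generated by $\{w_{j,a,x}\}_j$ and by $\{w_{j,b,\sigma(x)}\}_j$,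 coincide and are equal to the face generated by $u_x$. 2. The probabilities of classical decompositions of a state are unique: for any two classical decompositions of the same state, the families of non-zero probabilities agree up to a bijection of the indices; for two classical decompositions into maximal frames, the full families of probabilities agree up to a bijection. 3. $\ln w$ is well-defined for every state $w$: $w$ has a classical decomposition $w=\sum_j p_jw_j$ into a maximal frame, and $\ln w:=\sum_j\ln(p_j)\,w_j$ does not depend on the choice of this decomposition, where $\ln 0$ may be given any fixed real value. If $w=\sum_x p_x\sum_j w_{j,x}$ is a decomposition as in 1, then also $\ln w=\sum_x\ln(p_x)\sum_j w_{j,x}$. 4. For every function $f:\mathbb R\to\mathbb R$ and every $\mathcal A$ that has a decomposition as in 1, $f(\mathcal A):=\sum_x f(a_x)\sum_j w_{j,a,x}$ does not depend on the choice of the decomposition. -/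

import Mathlib

noncomputable section

namespace GPT

/-! ### Convex geometry -/

/-- `K` is a (pointed) cone. -/
structure IsCone {V : Type*} [AddCommGroup V] [Module ℝ V] (K : Set V) : Prop where
  nonempty : K.Nonempty
  add_mem : ∀ x ∈ K, ∀ y ∈ K, x + y ∈ K
  smul_mem : ∀ r : ℝ, 0 ≤ r → ∀ x ∈ K, r • x ∈ K
  pointed : ∀ x ∈ K, -x ∈ K → x = 0

/-- `F` is a face of the convex set `C`: a nonempty convex subset such that any two points of `C`
with a proper convex combination in `F` belong to `F`. -/
structure IsFaceOf {V : Type*} [AddCommGroup V] [Module ℝ V] (C F : Set V) : Prop where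
  nonempty : F.Nonempty
  convex : Convex ℝ F
  extreme : IsExtreme ℝ C F

/-- The face of `C` generated by `M`: the intersection of all faces of `C` containing `M`. -/
def faceGenerated {V : Type*} [AddCommGroup V] [Module ℝ V] (C M : Set V) : Set V :=
  ⋂₀ {F : Set V | IsFaceOf C F ∧ M ⊆ F}

/-! ### State spaces -/

/-- An abstract state space `(A, Ω, u)` on the finite-dimensional real vector space `A`.
(The norm of `A` only serves to speak about compact and closed sets.) -/
structure AbstractStateSpace (A : Type*) [NormedAddCommGroup A] [NormedSpace ℝ A]
    [FiniteDimensional ℝ A] where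
  /-- the normalized states -/
  states : Set A
  /-- the order unit -/
  unit : Module.Dual ℝ A
  convex_states : Convex ℝ states
  compact_states : IsCompact states
  /-- `ℝ≥0 · Ω` is a closed generating cone -/
  isCone : IsCone {x : A | ∃ r : ℝ, 0 ≤ r ∧ ∃ w ∈ states, x = r • w}
  closed_cone : IsClosed {x : A | ∃ r : ℝ, 0 ≤ r ∧ ∃ w ∈ states, x = r • w}
  generating : Submodule.span ℝ {x : A | ∃ r : ℝ, 0 ≤ r ∧ ∃ w ∈ states, x = r • w} = ⊤
  unit_pos : ∀ x : A, (∃ r : ℝ, 0 ≤ r ∧ ∃ w ∈ states, x = r • w) → x ≠ 0 → 0 < unit x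
  unit_eq_one_iff : ∀ x : A, (∃ r : ℝ, 0 ≤ r ∧ ∃ w ∈ states, x = r • w) →
    (unit x = 1 ↔ x ∈ states)

namespace AbstractStateSpace

variable {A : Type*} [NormedAddCommGroup A] [NormedSpace ℝ A] [FiniteDimensional ℝ A]

/-- The cone `A₊ = ℝ≥0 · Ω` of unnormalized states. -/
def cone (S : AbstractStateSpace A) : Set A :=
  {x : A | ∃ r : ℝ, 0 ≤ r ∧ ∃ w ∈ S.states, x = r • w}

/-- The set of (mathematically well-defined) effects. -/
def effects (S : AbstractStateSpace A) : Set (Module.Dual ℝ A) :=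
  {e | ∀ x ∈ S.cone, 0 ≤ e x ∧ e x ≤ S.unit x}

/-- `T` is a transformation of `A` to itself: linear, positive and normalization-non-increasing. -/
def IsTransformation (S : AbstractStateSpace A) (T : A →ₗ[ℝ] A) : Prop :=
  (∀ x ∈ S.cone, T x ∈ S.cone) ∧ ∀ x ∈ S.cone, S.unit (T x) ≤ S.unit x

end AbstractStateSpace

/-- A dynamical state space: an abstract state space together with its physically allowed effects
and its group of (physically) reversible transformations. -/
structure DynamicalStateSpace (A : Type*) [NormedAddCommGroup A] [NormedSpace ℝ A]
    [FiniteDimensional ℝ A] extends AbstractStateSpace A where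
  /-- the physically allowed effects -/
  allowed : Set (Module.Dual ℝ A)
  /-- the group of physically allowed reversible transformations -/
  reversible : Subgroup (A ≃ₗ[ℝ] A)
  allowed_subset : allowed ⊆ toAbstractStateSpace.effects
  convex_allowed : Convex ℝ allowed
  /-- the allowed effects have full dimension -/
  span_allowed : Submodule.span ℝ allowed = ⊤
  /-- the counter-event of an allowed effect is allowed -/
  compl_allowed : ∀ e ∈ allowed, toAbstractStateSpace.unit - e ∈ allowed
  /-- coarse-graining of allowed effects is allowed -/
  add_allowed : ∀ e ∈ allowed, ∀ f ∈ allowed, e + f ∈ toAbstractStateSpace.effects →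
    e + f ∈ allowed
  /-- as `reversible` is a group, the inverse of each member is a transformation, too -/
  isTransformation : ∀ T ∈ reversible,
    toAbstractStateSpace.IsTransformation (T : A →ₗ[ℝ] A)
  /-- an allowed transformation followed by an allowed effect is an allowed effect -/
  comp_allowed : ∀ T ∈ reversible, ∀ e ∈ allowed, e ∘ₗ (T : A →ₗ[ℝ] A) ∈ allowed

namespace DynamicalStateSpace

variable {A : Type*} [NormedAddCommGroup A] [NormedSpace ℝ A] [FiniteDimensional ℝ A]

/-- The states `w i` are perfectly distinguishable: there are allowed effects `e i` with
`∑ i, e i ≤ u` (so that they can appear in a common measurement) and `e i (w j) = δ_ij`. -/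
def PerfectlyDistinguishable (S : DynamicalStateSpace A) {ι : Type*} [Fintype ι] (w : ι → A) :
    Prop :=
  (∀ i, w i ∈ S.states) ∧
    ∃ e : ι → Module.Dual ℝ A, (∀ i, e i ∈ S.allowed) ∧
      (∀ x ∈ S.cone, ∑ i, e i x ≤ S.unit x) ∧
      (∀ i, e i (w i) = 1) ∧ ∀ i j, i ≠ j → e i (w j) = 0

/-- A frame: a finite family of perfectly distinguishable pure states (extreme points of `Ω`). -/
def IsFrame (S : DynamicalStateSpace A) {ι : Type*} [Fintype ι] (w : ι → A) : Prop :=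
  (∀ i, w i ∈ Set.extremePoints ℝ S.states) ∧ S.PerfectlyDistinguishable w

/-- A maximal frame: a frame that is not part of a strictly larger frame. -/
def IsMaximalFrame (S : DynamicalStateSpace A) {ι : Type*} [Fintype ι] (w : ι → A) : Prop :=
  S.IsFrame w ∧ ∀ (n : ℕ) (v : Fin n → A), S.IsFrame v →
    Set.range w ⊆ Set.range v → Set.range v = Set.range w

/-- `w = ∑ j, p j • v j` is a classical decomposition of the state `w`: `p` is a probability
distribution and `v` is a frame. -/
def IsClassicalDecomposition (S : DynamicalStateSpace A) (w : A) {n : ℕ} (p : Fin n → ℝ)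
    (v : Fin n → A) : Prop :=
  (∀ j, 0 ≤ p j) ∧ ∑ j, p j = 1 ∧ S.IsFrame v ∧ w = ∑ j, p j • v j

/-- Postulate 1, classical decomposability. -/
def ClassicalDecomposability (S : DynamicalStateSpace A) : Prop :=
  ∀ w ∈ S.states, ∃ (n : ℕ) (p : Fin n → ℝ) (v : Fin n → A), S.IsClassicalDecomposition w p v

/-- Postulate 2, strong symmetry. -/
def StrongSymmetry (S : DynamicalStateSpace A) : Prop :=
  ∀ (n : ℕ) (w v : Fin n → A), S.IsFrame w → S.IsFrame v →
    ∃ T ∈ S.reversible, ∀ j, T (w j) = v j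

/-- A decomposition `𝒜 = ∑ x, a x • ∑ j, w x j` of an observable, with pairwise distinct real
`a x` (each of which occurs, i.e. has positive multiplicity) and the `w x j` forming, all together,
a maximal frame. -/
structure ObservableDecomposition (S : DynamicalStateSpace A) (𝒜 : A) where
  /-- number of eigenvalues -/
  n : ℕ
  /-- eigenvalues -/
  a : Fin n → ℝ
  /-- multiplicities -/
  mult : Fin n → ℕ
  /-- the frame -/
  w : (x : Fin n) → Fin (mult x) → A
  injective_a : Function.Injective a
  mult_pos : ∀ x, 0 < mult x
  maximal : S.IsMaximalFrame (fun i : (x : Fin n) × Fin (mult x) => w i.1 i.2)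
  eq_sum : 𝒜 = ∑ x, a x • ∑ j, w x j

namespace ObservableDecomposition

variable {S : DynamicalStateSpace A} {𝒜 : A}

/-- The eigenface unit `u_x = ∑ j, w x j`. -/
def faceUnit (D : S.ObservableDecomposition 𝒜) (x : Fin D.n) : A := ∑ j, D.w x j

/-- The eigenface: the face of `A₊` generated by the `w x j`, for fixed `x`. -/
def eigenface (D : S.ObservableDecomposition 𝒜) (x : Fin D.n) : Set A :=
  faceGenerated S.cone (Set.range (D.w x))

/-- `∑ x, f (a x) • ∑ j, w x j`, the value of `f(𝒜)` computed from the decomposition. -/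
def apply (D : S.ObservableDecomposition 𝒜) (f : ℝ → ℝ) : A :=
  ∑ x, f (D.a x) • ∑ j, D.w x j

end ObservableDecomposition

end DynamicalStateSpace

end GPT

end

noncomputable section

namespace GPT

open Module

/-! ### Order structure of the cone -/

namespace AbstractStateSpace

variable {A : Type*} [NormedAddCommGroup A] [NormedSpace ℝ A] [FiniteDimensional ℝ A]
  (S : AbstractStateSpace A)

/-! The heart is an invariant inner product for which every frame is orthonormal and pairing with a
frame member is nonnegative on the cone. Second moments over the subnormalized states give an
invariant inner product `B`, with the order unit represented by an invariant interior point `m`. By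
the postulates `m` is a multiple of the sum of a frame of largest size (`exists_frame_sum_eq`); `B`
has one diagonal and one off-diagonal value on that frame, so subtracting a multiple of `u ⊗ u` and
rescaling makes it orthonormal (`nonempty_frameForm`). A norm estimate identifies the distinguishing
effects of a largest frame with pairings against its members (`form_frame_nonneg`).

For frames `w`, `v` the matrix `D i k = ⟨w i, v k⟩` is then doubly substochastic, and doubly
stochastic if both frames are maximal. The identity `form_sub_self` writes `‖∑ a i • w i - ∑ b k • v
k‖²` as a sum of nonnegative terms. If the two sums agree, `D i k ≠ 0` forces `a i = b k`, and the
identity for `f ∘ a`, `f ∘ b` gives zero again (`sum_apply_eq`). Indicator functions `f` recover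
eigenvalues, multiplicities and eigenface units. -/

theorem states_subset_cone : S.states ⊆ S.cone := fun w hw => ⟨1, zero_le_one, w, hw, by simp⟩

variable {S}

theorem unit_eq_one {w : A} (hw : w ∈ S.states) : S.unit w = 1 :=
  (S.unit_eq_one_iff w (S.states_subset_cone hw)).2 hw

theorem add_mem_cone {x y : A} (hx : x ∈ S.cone) (hy : y ∈ S.cone) : x + y ∈ S.cone :=
  S.isCone.add_mem x hx y hy

theorem smul_mem_cone {r : ℝ} (hr : 0 ≤ r) {x : A} (hx : x ∈ S.cone) : r • x ∈ S.cone :=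
  S.isCone.smul_mem r hr x hx

variable (S) in
theorem zero_mem_cone : (0 : A) ∈ S.cone := by
  obtain ⟨x, hx⟩ := S.isCone.nonempty
  simpa using smul_mem_cone (S := S) le_rfl hx

theorem sum_mem_cone {ι : Type*} {s : Finset ι} {f : ι → A} (h : ∀ i ∈ s, f i ∈ S.cone) :
    ∑ i ∈ s, f i ∈ S.cone :=
  Finset.sum_induction f (· ∈ S.cone) (fun _ _ => add_mem_cone) S.zero_mem_cone h

theorem unit_nonneg {x : A} (hx : x ∈ S.cone) : 0 ≤ S.unit x := by
  by_cases h : x = 0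
  · simp [h]
  · exact (S.unit_pos x hx h).le

variable (S) in
theorem states_nonempty : S.states.Nonempty := by
  obtain ⟨x, r, -, w, hw, -⟩ := S.isCone.nonempty
  exact ⟨w, hw⟩

variable (S) in
theorem unit_ne_zero : S.unit ≠ 0 := by
  obtain ⟨w, hw⟩ := S.states_nonempty
  intro h
  simpa [h] using unit_eq_one hw

variable (S) in
theorem convex_cone : Convex ℝ S.cone := fun _ hx _ hy _ _ ha hb _ =>
  add_mem_cone (smul_mem_cone ha hx) (smul_mem_cone hb hy)

theorem exists_state_of_mem_cone {x : A} (hx : x ∈ S.cone) :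
    ∃ w ∈ S.states, x = S.unit x • w := by
  obtain ⟨r, hr, w, hw, rfl⟩ := hx
  exact ⟨w, hw, by simp [unit_eq_one hw]⟩

theorem eq_of_eqOn_cone {e f : Dual ℝ A} (h : ∀ x ∈ S.cone, e x = f x) : e = f :=
  LinearMap.ext_on S.generating h

/-- Subnormalized states. -/
def subnormalized (S : AbstractStateSpace A) : Set A := {x | x ∈ S.cone ∧ S.unit x ≤ 1}

variable (S) in
theorem subnormalized_eq_image :
    S.subnormalized = (fun q : ℝ × A => q.1 • q.2) '' (Set.Icc 0 1 ×ˢ S.states) := by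
  ext x
  constructor
  · rintro ⟨hx, h1⟩
    obtain ⟨w, hw, h⟩ := exists_state_of_mem_cone hx
    exact ⟨(S.unit x, w), ⟨⟨unit_nonneg hx, h1⟩, hw⟩, h.symm⟩
  · rintro ⟨⟨r, w⟩, ⟨⟨h0, h1⟩, hw⟩, rfl⟩
    exact ⟨⟨r, h0, w, hw, rfl⟩, by simpa [unit_eq_one hw] using h1⟩

variable (S) in
theorem isCompact_subnormalized : IsCompact S.subnormalized := by
  rw [subnormalized_eq_image]
  exact (isCompact_Icc.prod S.compact_states).image (by fun_prop)

variable (S) in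
theorem convex_subnormalized : Convex ℝ S.subnormalized :=
  S.convex_cone.inter (convex_halfSpace_le S.unit.isLinear 1)

variable (S) in
-- Unlike `S.states`, this set contains `0` and so is full-dimensional; being compact as well, it
-- has finite positive Haar measure.
theorem affineSpan_subnormalized : affineSpan ℝ S.subnormalized = ⊤ := by
  have h0 : (0 : A) ∈ S.subnormalized := ⟨S.zero_mem_cone, by simp⟩
  have h0' : (0 : A) ∈ affineSpan ℝ S.subnormalized := subset_affineSpan _ _ h0
  rw [AffineSubspace.affineSpan_eq_top_iff_vectorSpan_eq_top_of_nonempty ℝ A A ⟨0, h0⟩,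
    eq_top_iff, ← S.generating, Submodule.span_le]
  rintro _ ⟨r, -, w, hw, rfl⟩
  have hw' : w ∈ S.subnormalized := ⟨S.states_subset_cone hw, (unit_eq_one hw).le⟩
  exact Submodule.smul_mem _ _ (by simpa using vsub_mem_vectorSpan ℝ hw' h0)

variable (S) in
theorem interior_subnormalized_nonempty : (interior S.subnormalized).Nonempty :=
  S.convex_subnormalized.interior_nonempty_iff_affineSpan_eq_top.2 S.affineSpan_subnormalized

variable (S) in
theorem interior_cone_nonempty : (interior S.cone).Nonempty :=
  S.interior_subnormalized_nonempty.mono (interior_mono fun _ h => h.1)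

/-- A point on which all nonzero positive functionals are strictly positive is interior. -/
theorem mem_interior_cone {m : A}
    (h : ∀ e : Dual ℝ A, e ≠ 0 → (∀ x ∈ S.cone, 0 ≤ e x) → 0 < e m) : m ∈ interior S.cone := by
  by_contra hm
  obtain ⟨f, hf⟩ := geometric_hahn_banach_open_point S.convex_cone.interior isOpen_interior hm
  obtain ⟨k, hk⟩ := S.interior_cone_nonempty
  have hle : ∀ x ∈ S.cone, f x ≤ f m := by
    intro x hx
    have hx' : x ∈ closure (interior S.cone) :=
      (S.convex_cone.closure_interior_eq_closure_of_nonempty_interior ⟨k, hk⟩).ge (subset_closure hx)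
    exact closure_minimal (fun y hy => (hf y hy).le) (isClosed_le f.continuous continuous_const) hx'
  have hm0 : 0 ≤ f m := by simpa using hle 0 S.zero_mem_cone
  -- A functional bounded above on a cone is nonpositive there: otherwise a suitable multiple of `x`
  -- attains `f m + 1`.
  have hneg : ∀ x ∈ S.cone, f x ≤ 0 := by
    intro x hx
    by_contra! hpos
    have := hle _ (smul_mem_cone (r := (f m + 1) / f x) (by positivity) hx)
    rw [map_smul, smul_eq_mul, div_mul_cancel₀ _ hpos.ne'] at this
    linarith
  have := h (-(f : A →ₗ[ℝ] ℝ)) (by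
    intro h0
    have hz : ∀ x, f x = 0 := fun x => by simpa using LinearMap.congr_fun h0 x
    simpa [hz] using hf k hk) (by simpa using hneg)
  simp only [LinearMap.neg_apply, ContinuousLinearMap.coe_coe] at this
  linarith

/-- Interior points are order units: `m + t • x` stays in the cone for small `t > 0`; divide by `t`.
-/
theorem exists_add_smul_mem_cone {m : A} (hm : m ∈ interior S.cone) (x : A) :
    ∃ r : ℝ, x + r • m ∈ S.cone := by
  have ht : Filter.Tendsto (fun t : ℝ => m + t • x) (nhdsWithin 0 (Set.Ioi 0)) (nhds m) := by
    have : Continuous fun t : ℝ => m + t • x := by fun_prop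
    simpa using (this.tendsto 0).mono_left nhdsWithin_le_nhds
  obtain ⟨t, ht, ht0⟩ :=
    ((ht.eventually (mem_interior_iff_mem_nhds.1 hm)).and self_mem_nhdsWithin).exists
  have ht0 : 0 < t := ht0
  refine ⟨t⁻¹, ?_⟩
  have := smul_mem_cone (S := S) (inv_nonneg.2 ht0.le) ht
  rwa [smul_add, smul_smul, inv_mul_cancel₀ ht0.ne', one_smul, add_comm] at this

theorem eq_zero_of_apply_interior_eq_zero {m : A} (hm : m ∈ interior S.cone) {e : Dual ℝ A}
    (he : ∀ x ∈ S.cone, 0 ≤ e x) (h : e m = 0) : e = 0 := by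
  have hnn : ∀ x, 0 ≤ e x := fun x => by
    obtain ⟨r, hr⟩ := exists_add_smul_mem_cone hm x
    simpa [h] using he _ hr
  ext x
  have hx := hnn (-x)
  rw [map_neg] at hx
  exact le_antisymm (neg_nonneg.1 hx) (hnn x)

/-! ### Faces of the cone -/

theorem smul_mem_of_isFaceOf {F : Set A} (hF : IsFaceOf S.cone F) {z : A} (hz : z ∈ F) {t : ℝ}
    (ht : 0 < t) : t • z ∈ F := by
  have hzc := hF.extreme.subset hz
  -- `z` lies between `t • z` and `t⁻¹ • z`, which treats all `t > 0` at once.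
  have hs : z ∈ openSegment ℝ (t • z) (t⁻¹ • z) := by
    refine ⟨1 / (1 + t), t / (1 + t), by positivity, by positivity, by field_simp, ?_⟩
    rw [smul_smul, smul_smul, ← add_smul]
    convert one_smul ℝ z using 2
    field_simp
    ring
  exact hF.extreme.left_mem_of_mem_openSegment (smul_mem_cone ht.le hzc)
    (smul_mem_cone (by positivity) hzc) hz hs

theorem mem_of_add_mem_isFaceOf {F : Set A} (hF : IsFaceOf S.cone F) {x y : A} (hx : x ∈ S.cone)
    (hy : y ∈ S.cone) (h : x + y ∈ F) : x ∈ F := by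
  -- `x + y` is the midpoint of `2 • x` and `2 • y`.
  have h2 : (2 : ℝ) • x ∈ F := by
    refine hF.extreme.left_mem_of_mem_openSegment (smul_mem_cone two_pos.le hx)
      (smul_mem_cone two_pos.le hy) h ⟨2⁻¹, 2⁻¹, by norm_num, by norm_num, by norm_num, ?_⟩
    simp [smul_smul]
  simpa [smul_smul] using smul_mem_of_isFaceOf hF h2 (t := 2⁻¹) (by norm_num)

theorem sum_mem_isFaceOf_iff {F : Set A} (hF : IsFaceOf S.cone F) {ι : Type*} [Fintype ι]
    [Nonempty ι] {w : ι → A} (hw : ∀ i, w i ∈ S.cone) : ∑ i, w i ∈ F ↔ ∀ i, w i ∈ F := by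
  classical
  constructor
  · intro h i
    rw [← Finset.add_sum_erase _ _ (Finset.mem_univ i)] at h
    exact mem_of_add_mem_isFaceOf hF (hw i) (sum_mem_cone fun j _ => hw j) h
  · intro h
    have hc : (0 : ℝ) < Fintype.card ι := by exact_mod_cast Fintype.card_pos
    have hm : ∑ i, (Fintype.card ι : ℝ)⁻¹ • w i ∈ F :=
      hF.convex.sum_mem (fun _ _ => by positivity) (by simp) fun i _ => h i
    have := smul_mem_of_isFaceOf hF hm hc
    rwa [← Finset.smul_sum, smul_smul, mul_inv_cancel₀ hc.ne', one_smul] at this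

/-- A face contains the sum exactly when it contains every summand, so both intersections run over
the same faces. -/
theorem faceGenerated_range {ι : Type*} [Fintype ι] [Nonempty ι] {w : ι → A}
    (hw : ∀ i, w i ∈ S.cone) :
    faceGenerated S.cone (Set.range w) = faceGenerated S.cone {∑ i, w i} := by
  unfold faceGenerated
  congr 1
  ext F
  simp only [Set.mem_ofPred_eq, Set.singleton_subset_iff, Set.range_subset_iff]
  exact and_congr_right fun hF => (sum_mem_isFaceOf_iff hF hw).symm

end AbstractStateSpace

/-! ### Invariant inner product from second moments -/

namespace AbstractStateSpace

open MeasureTheory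

variable {A : Type*} [NormedAddCommGroup A] [NormedSpace ℝ A] [FiniteDimensional ℝ A]
  (S : AbstractStateSpace A)

section Integral

variable [MeasurableSpace A] [BorelSpace A]

theorem integrableOn_mul (e f : Dual ℝ A) :
    IntegrableOn (fun x => e x * f x) S.subnormalized (Measure.addHaar : Measure A) := by
  have he := e.continuous_of_finiteDimensional
  have hf := f.continuous_of_finiteDimensional
  exact (he.mul hf).continuousOn.integrableOn_compact S.isCompact_subnormalized

/-- The moment form `(e, f) ↦ ∫ e f` over the subnormalized states. -/
def momentForm : Dual ℝ A →ₗ[ℝ] Dual ℝ A →ₗ[ℝ] ℝ :=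
  LinearMap.mk₂ ℝ (fun e f => ∫ x in S.subnormalized, e x * f x ∂(Measure.addHaar : Measure A))
    (fun e e' f => by
      simp only [LinearMap.add_apply, add_mul]
      exact integral_add (S.integrableOn_mul e f) (S.integrableOn_mul e' f))
    (fun r e f => by
      simp only [LinearMap.smul_apply, smul_eq_mul, mul_assoc]
      exact integral_const_mul _ _)
    (fun e f f' => by
      simp only [LinearMap.add_apply, mul_add]
      exact integral_add (S.integrableOn_mul e f) (S.integrableOn_mul e f'))
    (fun r e f => by
      simp only [LinearMap.smul_apply, smul_eq_mul, mul_left_comm _ r]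
      exact integral_const_mul _ _)

theorem momentForm_apply (e f : Dual ℝ A) : S.momentForm e f =
    ∫ x in S.subnormalized, e x * f x ∂(Measure.addHaar : Measure A) := rfl

theorem momentForm_comm (e f : Dual ℝ A) : S.momentForm e f = S.momentForm f e := by
  simp only [momentForm_apply, mul_comm]

theorem addHaar_ker {e : Dual ℝ A} (he : e ≠ 0) :
    (Measure.addHaar : Measure A) (LinearMap.ker e : Set A) = 0 := by
  apply Measure.addHaar_submodule
  rwa [Ne, LinearMap.ker_eq_top]

theorem addHaar_subnormalized_pos :
    0 < (Measure.addHaar : Measure A) S.subnormalized :=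
  Measure.measure_pos_of_nonempty_interior _ S.interior_subnormalized_nonempty

/-- The integrand vanishes only on two hyperplanes, which are null sets. -/
theorem momentForm_pos {e f : Dual ℝ A} (he : e ≠ 0) (hf : f ≠ 0)
    (h : ∀ x ∈ S.subnormalized, 0 ≤ e x * f x) : 0 < S.momentForm e f := by
  have hm : MeasurableSet S.subnormalized := S.isCompact_subnormalized.isClosed.measurableSet
  rw [momentForm_apply, setIntegral_pos_iff_support_of_nonneg_ae
    ((ae_restrict_iff' hm).2 (.of_forall h)) (S.integrableOn_mul e f)]
  have hsub : S.subnormalized ⊆ (Function.support (fun x => e x * f x) ∩ S.subnormalized) ∪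
      ((LinearMap.ker e : Set A) ∪ (LinearMap.ker f : Set A)) := by
    intro x hx
    by_cases h0 : e x * f x = 0
    · exact Or.inr (by simpa using h0)
    · exact Or.inl ⟨h0, hx⟩
  by_contra! hle
  refine (S.addHaar_subnormalized_pos).not_ge ((measure_mono hsub).trans ?_)
  refine (measure_union_le _ _).trans ?_
  rw [measure_union_null (addHaar_ker he) (addHaar_ker hf), add_zero]
  exact hle

/-- A linear symmetry of a set of finite positive volume has determinant `±1`; then change
variables. -/
theorem momentForm_comp (T : A ≃ₗ[ℝ] A) (hT : T '' S.subnormalized = S.subnormalized)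
    (e f : Dual ℝ A) :
    S.momentForm (e ∘ₗ (T : A →ₗ[ℝ] A)) (f ∘ₗ (T : A →ₗ[ℝ] A)) = S.momentForm e f := by
  have hm : MeasurableSet S.subnormalized := S.isCompact_subnormalized.isClosed.measurableSet
  have hd : ENNReal.ofReal |LinearMap.det (T : A →ₗ[ℝ] A)| = 1 := by
    have := Measure.addHaar_image_linearMap (Measure.addHaar : Measure A) (T : A →ₗ[ℝ] A)
      S.subnormalized
    rw [LinearEquiv.coe_coe, hT] at this
    exact (ENNReal.mul_eq_right S.addHaar_subnormalized_pos.ne'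
      S.isCompact_subnormalized.measure_ne_top).1 this.symm
  have hd' : |LinearMap.det (T : A →ₗ[ℝ] A)| = 1 := by simpa using hd
  let T' : A →L[ℝ] A := LinearMap.toContinuousLinearMap (T : A →ₗ[ℝ] A)
  have := integral_image_eq_integral_abs_det_fderiv_smul (Measure.addHaar : Measure A) hm
    (f := T) (f' := fun _ => T') (fun x _ => T'.hasFDerivWithinAt) T.injective.injOn
    (fun x => e x * f x)
  rw [hT] at this
  have hdet : T'.det = LinearMap.det (T : A →ₗ[ℝ] A) := rfl
  simp only [hdet, hd', one_smul] at this
  rw [momentForm_apply, momentForm_apply, this]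
  rfl

end Integral

/-- There is an inner product on `A` that is invariant under all symmetries of the subnormalized
states, and for which the order unit is represented by an interior point of the cone. -/
theorem exists_invariant_form :
    ∃ (B : A →ₗ[ℝ] A →ₗ[ℝ] ℝ) (m : A), (∀ x y, B x y = B y x) ∧ (∀ x, x ≠ 0 → 0 < B x x) ∧
      (∀ T : A ≃ₗ[ℝ] A, T '' S.subnormalized = S.subnormalized → ∀ x y, B (T x) (T y) = B x y) ∧
      (∀ x, B m x = S.unit x) ∧ m ∈ interior S.cone := by
  let _ : MeasurableSpace A := borel A
  have : BorelSpace A := ⟨rfl⟩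
  -- `J₀ e` is the moment vector `∫ e(x) x`. Its inverse, read as a bilinear form, is the required
  -- `B`, and `m` is the moment vector of the unit.
  let J₀ : Dual ℝ A →ₗ[ℝ] A := (evalEquiv ℝ A).symm ∘ₗ S.momentForm
  have hJ₀ : ∀ e f : Dual ℝ A, f (J₀ e) = S.momentForm e f := fun e f => by
    simp [J₀, Module.apply_evalEquiv_symm_apply]
  have hpos : ∀ e : Dual ℝ A, e ≠ 0 → 0 < S.momentForm e e := fun e he =>
    S.momentForm_pos he he fun _ _ => mul_self_nonneg _
  have hinj : Function.Injective J₀ := by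
    rw [← LinearMap.ker_eq_bot, LinearMap.ker_eq_bot']
    intro e he
    by_contra h0
    have := hJ₀ e e
    rw [he, map_zero] at this
    exact (hpos e h0).ne this
  let J : Dual ℝ A ≃ₗ[ℝ] A :=
    LinearEquiv.ofInjectiveOfFinrankEq J₀ hinj (Subspace.dual_finrank_eq)
  have hJ : ∀ e f : Dual ℝ A, f (J e) = S.momentForm e f := hJ₀
  refine ⟨J.symm, J S.unit, fun x y => ?_, fun x hx => ?_, fun T hT x y => ?_, fun x => by simp, ?_⟩
  · obtain ⟨e, rfl⟩ := J.surjective x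
    obtain ⟨f, rfl⟩ := J.surjective y
    simp [hJ, S.momentForm_comm e f]
  · obtain ⟨e, rfl⟩ := J.surjective x
    have : e ≠ 0 := by rintro rfl; simp at hx
    simpa [hJ] using hpos e this
  · obtain ⟨e, rfl⟩ := J.surjective x
    -- Invariance of the moment form says that `J` intertwines precomposition with `T` and the
    -- inverse of `T`.
    have key : ∀ e : Dual ℝ A, T (J (e ∘ₗ (T : A →ₗ[ℝ] A))) = J e := by
      intro e
      rw [← sub_eq_zero, ← Module.forall_dual_apply_eq_zero_iff ℝ]
      intro f
      have h1 := hJ (e ∘ₗ (T : A →ₗ[ℝ] A)) (f ∘ₗ (T : A →ₗ[ℝ] A))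
      rw [S.momentForm_comp T hT] at h1
      rw [map_sub, hJ, ← h1]
      simp
    obtain ⟨e', rfl⟩ : ∃ e' : Dual ℝ A, e = e' ∘ₗ (T : A →ₗ[ℝ] A) :=
      ⟨e ∘ₗ (T.symm : A →ₗ[ℝ] A), by ext; simp⟩
    rw [key]
    simp
  · refine mem_interior_cone fun e he h => ?_
    rw [hJ]
    exact S.momentForm_pos S.unit_ne_zero he fun x hx => mul_nonneg (unit_nonneg hx.1) (h x hx.1)

end AbstractStateSpace

/-! ### Reversible transformations and frames -/

namespace DynamicalStateSpace

variable {A : Type*} [NormedAddCommGroup A] [NormedSpace ℝ A] [FiniteDimensional ℝ A]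
  {S : DynamicalStateSpace A}

theorem map_mem_cone {T : A ≃ₗ[ℝ] A} (hT : T ∈ S.reversible) {x : A} (hx : x ∈ S.cone) :
    T x ∈ S.cone := (S.isTransformation T hT).1 x hx

theorem symm_mem_reversible {T : A ≃ₗ[ℝ] A} (hT : T ∈ S.reversible) : T.symm ∈ S.reversible :=
  S.reversible.inv_mem hT

/-- Neither `T` nor its inverse increases the unit on the cone, and the cone spans. -/
theorem unit_map {T : A ≃ₗ[ℝ] A} (hT : T ∈ S.reversible) (x : A) : S.unit (T x) = S.unit x := by
  have : S.unit ∘ₗ (T : A →ₗ[ℝ] A) = S.unit := by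
    refine AbstractStateSpace.eq_of_eqOn_cone (S := S.toAbstractStateSpace) fun x hx => le_antisymm ?_ ?_
    · exact (S.isTransformation T hT).2 x hx
    · simpa using (S.isTransformation _ (symm_mem_reversible hT)).2 _ (map_mem_cone hT hx)
  exact LinearMap.congr_fun this x

theorem image_subnormalized {T : A ≃ₗ[ℝ] A} (hT : T ∈ S.reversible) :
    T '' S.subnormalized = S.subnormalized := by
  have h : ∀ T ∈ S.reversible, ∀ x ∈ S.subnormalized, T x ∈ S.subnormalized := fun T hT x hx =>
    ⟨map_mem_cone hT hx.1, (unit_map hT x).trans_le hx.2⟩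
  refine Set.Subset.antisymm (Set.image_subset_iff.2 (h T hT)) fun x hx =>
    ⟨T.symm x, h _ (symm_mem_reversible hT) x hx, by simp⟩

theorem map_mem_states {T : A ≃ₗ[ℝ] A} (hT : T ∈ S.reversible) {x : A} (hx : x ∈ S.states) :
    T x ∈ S.states := by
  have hc := map_mem_cone hT (S.states_subset_cone hx)
  exact (S.unit_eq_one_iff _ hc).1 ((unit_map hT x).trans (AbstractStateSpace.unit_eq_one hx))

theorem map_mem_extremePoints {T : A ≃ₗ[ℝ] A} (hT : T ∈ S.reversible) {x : A}
    (hx : x ∈ Set.extremePoints ℝ S.states) : T x ∈ Set.extremePoints ℝ S.states := by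
  refine ⟨map_mem_states hT hx.1, fun y hy z hz hyz => ?_⟩
  have hs := symm_mem_reversible hT
  have h : x ∈ openSegment ℝ (T.symm y) (T.symm z) := by
    obtain ⟨a, b, ha, hb, hab, h⟩ := hyz
    exact ⟨a, b, ha, hb, hab, by rw [← map_smul, ← map_smul, ← map_add, h, T.symm_apply_apply]⟩
  rw [← hx.2 (map_mem_states hs hy) (map_mem_states hs hz) h, T.apply_symm_apply]

section Frame

variable {ι κ : Type*} [Fintype ι] [Fintype κ]

theorem IsFrame.mem_states {w : ι → A} (hw : S.IsFrame w) (i : ι) : w i ∈ S.states := hw.2.1 i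

theorem IsFrame.mem_cone {w : ι → A} (hw : S.IsFrame w) (i : ι) : w i ∈ S.cone :=
  S.states_subset_cone (hw.mem_states i)

theorem IsFrame.unit_eq_one {w : ι → A} (hw : S.IsFrame w) (i : ι) : S.unit (w i) = 1 :=
  AbstractStateSpace.unit_eq_one (hw.mem_states i)

theorem effect_nonneg {e : Dual ℝ A} (he : e ∈ S.allowed) {x : A} (hx : x ∈ S.cone) : 0 ≤ e x :=
  (S.allowed_subset he x hx).1

theorem IsFrame.injective {w : ι → A} (hw : S.IsFrame w) : Function.Injective w := by
  obtain ⟨-, -, e, -, -, h1, h0⟩ := hw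
  intro i j h
  by_contra hij
  have := h0 i j hij
  rw [← h, h1] at this
  exact one_ne_zero this

theorem IsFrame.comp {w : ι → A} (hw : S.IsFrame w) {g : κ → ι} (hg : Function.Injective g) :
    S.IsFrame (w ∘ g) := by
  classical
  obtain ⟨hp, hs, e, he, hu, h1, h0⟩ := hw
  refine ⟨fun i => hp _, fun i => hs _, e ∘ g, fun i => he _, fun x hx => ?_, fun i => h1 _,
    fun i j hij => h0 _ _ (hg.ne hij)⟩
  refine le_trans ?_ (hu x hx)
  simp only [Function.comp_apply]
  rw [← Finset.sum_image (s := Finset.univ) (g := g) (f := fun i => e i x) (by simp [hg.injOn])]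
  exact Finset.sum_le_sum_of_subset_of_nonneg (Finset.subset_univ _)
    fun i _ _ => effect_nonneg (he i) hx

theorem IsFrame.map {w : ι → A} (hw : S.IsFrame w) {T : A ≃ₗ[ℝ] A} (hT : T ∈ S.reversible) :
    S.IsFrame (fun i => T (w i)) := by
  obtain ⟨hp, hs, e, he, hu, h1, h0⟩ := hw
  have hs' := symm_mem_reversible hT
  refine ⟨fun i => map_mem_extremePoints hT (hp i), fun i => map_mem_states hT (hs i),
    fun i => e i ∘ₗ (T.symm : A →ₗ[ℝ] A), fun i => S.comp_allowed _ hs' _ (he i),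
    fun x hx => ?_, fun i => by simpa using h1 i, fun i j hij => by simpa using h0 i j hij⟩
  rw [← unit_map hs' x]
  exact hu _ (map_mem_cone hs' hx)

theorem StrongSymmetry.exists_map_eq (h2 : S.StrongSymmetry) {w v : ι → A} (hw : S.IsFrame w)
    (hv : S.IsFrame v) : ∃ T ∈ S.reversible, ∀ i, T (w i) = v i := by
  let g := (Fintype.equivFin ι).symm
  obtain ⟨T, hT, h⟩ := h2 _ (w ∘ g) (v ∘ g) (hw.comp g.injective) (hv.comp g.injective)
  exact ⟨T, hT, fun i => by simpa [g] using h (g.symm i)⟩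

end Frame

end DynamicalStateSpace

/-! ### Inner product adapted to frames -/

namespace DynamicalStateSpace

variable {A : Type*} [NormedAddCommGroup A] [NormedSpace ℝ A] [FiniteDimensional ℝ A]
  {S : DynamicalStateSpace A}

/-- An invariant interior point of the cone is a multiple of the sum over a frame, which has the
largest possible size. -/
theorem exists_frame_sum_eq (h1 : S.ClassicalDecomposability) (h2 : S.StrongSymmetry) {m : A}
    (hm : m ∈ interior S.cone) (hinv : ∀ T ∈ S.reversible, T m = m) :
    ∃ (n : ℕ) (v : Fin n → A) (c : ℝ), 0 < c ∧ 0 < n ∧ S.IsFrame v ∧ m = c • ∑ i, v i ∧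
      ∀ (k : ℕ) (w : Fin k → A), S.IsFrame w → k ≤ n := by
  have hmc : m ∈ S.cone := interior_subset hm
  have hm0 : 0 < S.unit m := by
    refine lt_of_le_of_ne (AbstractStateSpace.unit_nonneg hmc) fun h => ?_
    exact S.unit_ne_zero (AbstractStateSpace.eq_zero_of_apply_interior_eq_zero hm
      (fun x hx => AbstractStateSpace.unit_nonneg hx) h.symm)
  obtain ⟨s, hs, hms⟩ := AbstractStateSpace.exists_state_of_mem_cone hmc
  obtain ⟨n, p, v, hp, hp1, hv, hsv⟩ := h1 s hs
  have hn : 0 < n := by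
    rcases Nat.eq_zero_or_pos n with rfl | h
    · simp at hp1
    · exact h
  have hsinv : ∀ T ∈ S.reversible, T s = s := by
    intro T hT
    have := hinv T hT
    rw [hms, map_smul] at this
    exact smul_right_injective A hm0.ne' this
  -- Some symmetry swaps `v i` and `v j` and fixes the other members. It also fixes `s`, so applying
  -- `e j` compares the two weights.
  have hpc : ∀ i j, p i = p j := by
    intro i j
    obtain ⟨T, hT, h⟩ := h2.exists_map_eq hv (hv.comp (Equiv.swap i j).injective)
    have hT' := hsinv T hT
    obtain ⟨-, -, e, -, -, he1, he0⟩ := hv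
    have hek : ∀ k l, e k (v l) = if k = l then 1 else 0 := by
      intro k l
      split_ifs with hkl
      · rw [hkl, he1]
      · exact he0 k l hkl
    have := congrArg (e j) hT'
    rw [hsv] at this
    simp only [map_sum, map_smul, h, Function.comp_apply, hek, smul_eq_mul, mul_ite, mul_one,
      mul_zero, Finset.sum_ite_eq, Finset.mem_univ, if_true] at this
    rw [Finset.sum_eq_single i] at this
    · simpa using this
    · intro b _ hb
      rw [if_neg]
      intro hj
      exact hb (by simpa using congrArg (Equiv.swap i j) hj.symm)
    · simp
  let i₀ : Fin n := ⟨0, hn⟩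
  have hp0 : 0 < p i₀ := by
    refine lt_of_le_of_ne (hp i₀) fun h => ?_
    have : ∀ i, p i = 0 := fun i => (hpc i i₀).trans h.symm
    simp [this] at hp1
  have hmv : m = (S.unit m * p i₀) • ∑ i, v i := by
    rw [mul_smul, Finset.smul_sum, Finset.sum_congr rfl fun i _ => by rw [hpc i₀ i], ← hsv, ← hms]
  refine ⟨n, v, S.unit m * p i₀, by positivity, hn, hv, hmv, fun k w hw => ?_⟩
  by_contra! hk
  -- Move the first `n` members of a longer frame onto `v`. The effect of the member with index `n`
  -- then kills `m`, hence is zero.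
  obtain ⟨T, hT, h⟩ := h2.exists_map_eq (hw.comp (Fin.castLE_injective hk.le)) hv
  obtain ⟨-, -, e, he, -, he1, he0⟩ := hw.map hT
  have hz : e ⟨n, hk⟩ m = 0 := by
    rw [hmv, map_smul, map_sum, Finset.sum_eq_zero, smul_zero]
    intro i _
    rw [← h i]
    exact he0 _ _ (by simp [Fin.ext_iff, i.2.ne'])
  have h0 := AbstractStateSpace.eq_zero_of_apply_interior_eq_zero hm
    (fun x hx => effect_nonneg (he _) hx) hz
  have := he1 ⟨n, hk⟩
  rw [h0] at this
  simp at this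

/-- An invariant inner product for which a frame of largest size is orthonormal and sums up to the
representative of the order unit. -/
structure FrameForm (S : DynamicalStateSpace A) where
  form : A →ₗ[ℝ] A →ₗ[ℝ] ℝ
  comm : ∀ x y, form x y = form y x
  pos : ∀ x, x ≠ 0 → 0 < form x x
  map : ∀ T ∈ S.reversible, ∀ x y, form (T x) (T y) = form x y
  size : ℕ
  frame : Fin size → A
  isFrame : S.IsFrame frame
  le_size : ∀ (n : ℕ) (w : Fin n → A), S.IsFrame w → n ≤ size
  orthonormal : ∀ i j, form (frame i) (frame j) = if i = j then 1 else 0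
  form_sum : ∀ x, form (∑ i, frame i) x = S.unit x
  sum_mem_interior : ∑ i, frame i ∈ interior S.cone

/-- Symmetries act transitively on the members and on ordered pairs of distinct members, so the Gram
matrix has two values; `t < s` is positivity of `v i - v j`. -/
theorem exists_offDiagonal (h2 : S.StrongSymmetry) {B : A →ₗ[ℝ] A →ₗ[ℝ] ℝ}
    (hcomm : ∀ x y, B x y = B y x) (hpos : ∀ x, x ≠ 0 → 0 < B x x)
    (hinv : ∀ T ∈ S.reversible, ∀ x y, B (T x) (T y) = B x y)
    {n : ℕ} {v : Fin n → A} (hn : 0 < n) (hv : S.IsFrame v) :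
    ∃ s t : ℝ, t < s ∧ ∀ i j, B (v i) (v j) = if i = j then s else t := by
  have hd : ∀ i j, B (v i) (v i) = B (v j) (v j) := by
    intro i j
    obtain ⟨T, hT, h⟩ := h2.exists_map_eq hv (hv.comp (Equiv.swap i j).injective)
    rw [← hinv T hT (v i), h]
    simp
  have ho : ∀ i j k l, i ≠ j → k ≠ l → B (v i) (v j) = B (v k) (v l) := by
    intro i j k l hij hkl
    have hg : ∀ {a b : Fin n}, a ≠ b → Function.Injective ![a, b] := by
      intro a b hab x y
      fin_cases x <;> fin_cases y <;> simp [hab, hab.symm]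
    obtain ⟨T, hT, h⟩ := h2.exists_map_eq (hv.comp (hg hij)) (hv.comp (hg hkl))
    have h0 := h 0
    have h1 := h 1
    simp only [Function.comp_apply, Matrix.cons_val_zero, Matrix.cons_val_one] at h0 h1
    rw [← hinv T hT (v i), h0, h1]
  let i₀ : Fin n := ⟨0, hn⟩
  by_cases hex : ∃ i j : Fin n, i ≠ j
  · obtain ⟨i, j, hij⟩ := hex
    refine ⟨B (v i) (v i), B (v i) (v j), ?_, fun k l => ?_⟩
    · have := hpos (v i - v j) (sub_ne_zero.2 (hv.injective.ne hij))
      simp only [map_sub, LinearMap.sub_apply, hcomm (v j) (v i), hd j i] at this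
      linarith
    · split_ifs with h
      · rw [h, hd]
      · exact ho _ _ _ _ h hij
  · push Not at hex
    -- With a single member there is no off-diagonal entry, and any `t < s` serves.
    refine ⟨B (v i₀) (v i₀), B (v i₀) (v i₀) - 1, by linarith, fun k l => ?_⟩
    rw [if_pos (hex k l), hex l k, hd]

/-- The unit is invariant and equals `1` on states, so removing `t • u ⊗ u` keeps invariance and
clears the off-diagonal entries. Definiteness survives by Cauchy–Schwarz against `m`. -/
theorem nonempty_frameForm (h1 : S.ClassicalDecomposability) (h2 : S.StrongSymmetry) :
    Nonempty S.FrameForm := by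
  obtain ⟨B, m, hcomm, hpos, hinv, hBm, hm⟩ := S.exists_invariant_form
  have hinv' : ∀ T ∈ S.reversible, ∀ x y, B (T x) (T y) = B x y :=
    fun T hT => hinv T (image_subnormalized hT)
  have hTm : ∀ T ∈ S.reversible, T m = m := by
    intro T hT
    by_contra h
    refine (hpos _ (sub_ne_zero.2 h)).ne' ?_
    have key : ∀ x, B (T m) x = S.unit x := fun x => by
      have := hinv' T hT m (T.symm x)
      rwa [T.apply_symm_apply, hBm, unit_map (symm_mem_reversible hT)] at this
    rw [map_sub B, LinearMap.sub_apply, key, hBm, sub_self]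
  obtain ⟨n, v, c, hc, hn, hv, hmv, hmax⟩ := exists_frame_sum_eq h1 h2 hm hTm
  obtain ⟨s, t, hst, hB⟩ := exists_offDiagonal h2 hcomm hpos hinv' hn hv
  have hn0 : (0 : ℝ) < n := by exact_mod_cast hn
  have hum : S.unit (∑ i, v i) = n := by simp [hv.unit_eq_one]
  have hvm : ∑ i, v i = c⁻¹ • m := by rw [hmv, smul_smul, inv_mul_cancel₀ hc.ne', one_smul]
  have hBv : ∀ x, B (∑ i, v i) x = c⁻¹ * S.unit x := fun x => by
    rw [hvm, map_smul, LinearMap.smul_apply, hBm, smul_eq_mul]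
  -- This is a row sum of the Gram matrix.
  have hcst : c⁻¹ = (s - t) + n * t := by
    have h := hBv (v ⟨0, hn⟩)
    rw [hv.unit_eq_one, mul_one, map_sum, LinearMap.sum_apply] at h
    rw [← h, Finset.sum_congr rfl fun i _ => (by
      rw [hB]; split_ifs <;> simp : B (v i) (v ⟨0, hn⟩) = (if i = ⟨0, hn⟩ then s - t else 0) + t)]
    simp [Finset.sum_add_distrib]
  have hst0 : 0 < s - t := sub_pos.2 hst
  let U : A →ₗ[ℝ] A →ₗ[ℝ] ℝ := S.unit.smulRight S.unit
  have hU : ∀ x y, U x y = S.unit x * S.unit y := fun x y => by simp [U]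
  have hF : ∀ x y, ((s - t)⁻¹ • (B - t • U)) x y = (s - t)⁻¹ * (B x y - t * (S.unit x * S.unit y)) :=
    fun x y => by
      simp only [LinearMap.smul_apply, LinearMap.sub_apply, hU, smul_eq_mul]
  refine ⟨⟨(s - t)⁻¹ • (B - t • U), fun x y => ?_, fun x hx => ?_, fun T hT x y => ?_, n, v, hv,
    hmax, fun i j => ?_, fun x => ?_, ?_⟩⟩
  · rw [hF, hF, hcomm x y, mul_comm (S.unit x)]
  · rw [hF]
    refine mul_pos (inv_pos.2 hst0) ?_
    have hcs : S.unit x * S.unit x * c⁻¹ ≤ B x x * n := by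
      -- `z` is `n` times the component of `x` orthogonal to `m`.
      let z := (n : ℝ) • x - S.unit x • ∑ i, v i
      have hz : 0 ≤ B z z := by
        by_cases h : z = 0
        · simp [h]
        · exact (hpos z h).le
      simp only [z, map_sub, LinearMap.sub_apply, map_smul, LinearMap.smul_apply, hBv,
        hcomm x (∑ i, v i), hum, smul_eq_mul] at hz
      have : 0 ≤ n * (B x x * n - S.unit x * S.unit x * c⁻¹) := by linarith
      exact sub_nonneg.1 (nonneg_of_mul_nonneg_right this hn0)
    rw [hcst] at hcs
    have hxx := hpos x hx
    by_contra! hle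
    have h3 : B x x * n ≤ t * (S.unit x * S.unit x) * n :=
      mul_le_mul_of_nonneg_right (by linarith) hn0.le
    have h4 : S.unit x * S.unit x * (s - t) ≤ 0 := by linarith
    have h5 : S.unit x * S.unit x = 0 :=
      le_antisymm (nonpos_of_mul_nonpos_left h4 hst0) (mul_self_nonneg _)
    rw [h5] at hle
    linarith
  · rw [hF, hF, hinv' T hT, unit_map hT, unit_map hT]
  · rw [hF, hB, hv.unit_eq_one, hv.unit_eq_one]
    split_ifs
    · field_simp
    · simp
  · rw [hF, hBv, hum, hcst]
    field_simp
    ring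
  · refine AbstractStateSpace.mem_interior_cone fun e he h => ?_
    rw [hvm, map_smul]
    refine mul_pos (inv_pos.2 hc) (lt_of_le_of_ne (h m (interior_subset hm)) fun h0 => he ?_)
    exact AbstractStateSpace.eq_zero_of_apply_interior_eq_zero hm h h0.symm

namespace FrameForm

variable (Φ : S.FrameForm) {ι κ : Type*} [Fintype ι] [Fintype κ]

theorem eq_of_form_sub_le {x y : A} (h : Φ.form (x - y) (x - y) ≤ 0) : x = y := by
  by_contra hne
  exact (Φ.pos _ (sub_ne_zero.2 hne)).not_ge h

theorem nonneg (x : A) : 0 ≤ Φ.form x x := by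
  by_cases h : x = 0
  · simp [h]
  · exact (Φ.pos x h).le

theorem card_le {w : ι → A} (hw : S.IsFrame w) : Fintype.card ι ≤ Φ.size :=
  Φ.le_size _ _ (hw.comp (Fintype.equivFin ι).symm.injective)

/-- Every frame is part of a frame of largest size. -/
theorem exists_extension (h2 : S.StrongSymmetry) {w : ι → A} (hw : S.IsFrame w) :
    ∃ (g : ι ↪ Fin Φ.size) (v : Fin Φ.size → A), S.IsFrame v ∧ ∀ i, v (g i) = w i := by
  obtain ⟨g⟩ := Function.Embedding.nonempty_of_card_le (β := Fin Φ.size)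
    (by simpa using Φ.card_le hw)
  -- A symmetry carries a subframe of `Φ.frame` onto `w`; the image of all of `Φ.frame` is the
  -- extension.
  obtain ⟨T, hT, h⟩ := h2.exists_map_eq (Φ.isFrame.comp g.injective) hw
  exact ⟨g, _, Φ.isFrame.map hT, h⟩

/-- Both sums represent the order unit, since symmetries preserve the form and the unit. -/
theorem sum_eq (h2 : S.StrongSymmetry) {v : Fin Φ.size → A} (hv : S.IsFrame v) :
    ∑ i, v i = ∑ i, Φ.frame i := by
  obtain ⟨T, hT, h⟩ := h2.exists_map_eq Φ.isFrame hv
  have key : ∀ x, Φ.form (∑ i, v i) x = S.unit x := fun x => by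
    have := Φ.map T hT (∑ i, Φ.frame i) (T.symm x)
    rw [T.apply_symm_apply, Φ.form_sum, unit_map (symm_mem_reversible hT), map_sum] at this
    simpa only [h] using this
  refine Φ.eq_of_form_sub_le ?_
  rw [map_sub Φ.form, LinearMap.sub_apply, key, Φ.form_sum, sub_self]

theorem form_frame (h2 : S.StrongSymmetry) [DecidableEq ι] {w : ι → A} (hw : S.IsFrame w)
    (i j : ι) : Φ.form (w i) (w j) = if i = j then 1 else 0 := by
  obtain ⟨g, v, hv, h⟩ := Φ.exists_extension h2 hw
  obtain ⟨T, hT, hTv⟩ := h2.exists_map_eq Φ.isFrame hv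
  rw [← h, ← h, ← hTv, ← hTv, Φ.map T hT, Φ.orthonormal]
  simp

theorem exists_diagonal_of_mem_cone (h1 : S.ClassicalDecomposability) (h2 : S.StrongSymmetry)
    {x : A} (hx : x ∈ S.cone) : ∃ (p : Fin Φ.size → ℝ) (v : Fin Φ.size → A),
      (∀ i, 0 ≤ p i) ∧ S.IsFrame v ∧ x = ∑ i, p i • v i := by
  classical
  obtain ⟨w, hw, hxw⟩ := AbstractStateSpace.exists_state_of_mem_cone hx
  obtain ⟨n, p, w', hp, -, hw', rfl⟩ := h1 w hw
  obtain ⟨g, v, hv, h⟩ := Φ.exists_extension h2 hw'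
  -- The weights, padded with zeros outside the range of `g`.
  refine ⟨fun i => ∑ j, if g j = i then S.unit x * p j else 0, v, fun i => ?_, hv, ?_⟩
  · refine Finset.sum_nonneg fun j _ => ?_
    split_ifs
    · exact mul_nonneg (AbstractStateSpace.unit_nonneg hx) (hp j)
    · exact le_rfl
  · conv_lhs => rw [hxw]
    simp only [Finset.sum_smul, ite_smul, zero_smul]
    rw [Finset.sum_comm]
    simp [h, Finset.smul_sum, mul_smul]

/-- Adding a multiple of the order unit vector moves `x` into the cone, and every largest frame sums
to that vector, so the shift can be undone in the coefficients. -/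
theorem exists_diagonal (h1 : S.ClassicalDecomposability) (h2 : S.StrongSymmetry) (x : A) :
    ∃ (a : Fin Φ.size → ℝ) (v : Fin Φ.size → A), S.IsFrame v ∧ x = ∑ i, a i • v i := by
  obtain ⟨r, hr⟩ := AbstractStateSpace.exists_add_smul_mem_cone Φ.sum_mem_interior x
  obtain ⟨p, v, -, hv, h⟩ := Φ.exists_diagonal_of_mem_cone h1 h2 hr
  refine ⟨fun i => p i - r, v, hv, ?_⟩
  simp only [sub_smul, Finset.sum_sub_distrib, ← h, ← Finset.smul_sum, Φ.sum_eq h2 hv]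
  simp

theorem exists_form_eq (e : Dual ℝ A) : ∃ x, ∀ y, Φ.form x y = e y := by
  have hinj : Function.Injective Φ.form := by
    rw [← LinearMap.ker_eq_bot, LinearMap.ker_eq_bot']
    intro x hx
    by_contra h
    exact (Φ.pos x h).ne' (by simp [hx])
  have hs := (LinearMap.injective_iff_surjective_of_finrank_eq_finrank
    (Subspace.dual_finrank_eq (K := ℝ) (V := A)).symm).1 hinj
  obtain ⟨x, hx⟩ := hs e
  exact ⟨x, fun y => by rw [hx]⟩

theorem form_self_sum (h2 : S.StrongSymmetry) {w : ι → A} (hw : S.IsFrame w) (a : ι → ℝ) :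
    Φ.form (∑ i, a i • w i) (∑ i, a i • w i) = ∑ i, a i * a i := by
  classical
  simp [Φ.form_frame h2 hw]

/-- The form with a member of a frame is an effect: the distinguishing effects of a frame of
largest size are the forms with its members. -/
theorem form_frame_nonneg (h1 : S.ClassicalDecomposability) (h2 : S.StrongSymmetry) {w : ι → A}
    (hw : S.IsFrame w) (i : ι) {x : A} (hx : x ∈ S.cone) : 0 ≤ Φ.form (w i) x := by
  obtain ⟨g, v, hv, h⟩ := Φ.exists_extension h2 hw
  rw [← h]
  generalize g i = j
  obtain ⟨-, -, e, he, hu, he1, -⟩ := id hv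
  choose y hy using fun j => Φ.exists_form_eq (e j)
  have hle : ∀ j, Φ.form (y j - v j) (y j - v j) ≤ e j (∑ k, Φ.frame k) - 1 := by
    intro j
    -- The coefficients of `y j` are values of the effect `e j` on states, so they lie in `[0, 1]`;
    -- thus `‖y j‖² = ∑ a k ^ 2 ≤ ∑ a k`.
    obtain ⟨a, z, hz, hyz⟩ := Φ.exists_diagonal h1 h2 (y j)
    have ha : ∀ k, e j (z k) = a k := fun k => by
      rw [← hy, hyz]
      simp [Φ.form_frame h2 hz]
    have h01 : ∀ k, a k * a k ≤ a k := fun k => by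
      have := S.allowed_subset (he j) _ (hz.mem_cone k)
      rw [ha, hz.unit_eq_one] at this
      exact mul_le_of_le_one_right this.1 this.2
    have hyy : Φ.form (y j) (y j) ≤ e j (∑ k, Φ.frame k) := by
      have : Φ.form (y j) (y j) = ∑ k, a k * a k := by rw [hyz, Φ.form_self_sum h2 hz]
      rw [this, ← Φ.sum_eq h2 hz, map_sum]
      exact Finset.sum_le_sum fun k _ => (h01 k).trans (ha k).ge
    have hyv : Φ.form (y j) (v j) = 1 := by rw [hy, he1]
    have hvv : Φ.form (v j) (v j) = 1 := by simp [Φ.form_frame h2 hv]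
    simp only [map_sub, LinearMap.sub_apply, Φ.comm (v j) (y j), hyv, hvv]
    linarith
  -- As `∑ e j ≤ u`, the bounds add up to at most `size - size`, which forces `y j = v j` for every
  -- `j`.
  have hsum : ∑ j, Φ.form (y j - v j) (y j - v j) ≤ 0 := by
    refine (Finset.sum_le_sum fun j _ => hle j).trans ?_
    have h3 := hu _ (interior_subset Φ.sum_mem_interior)
    have h4 : S.unit (∑ k, Φ.frame k) = Φ.size := by simp [Φ.isFrame.unit_eq_one]
    rw [h4] at h3
    simpa [Finset.sum_sub_distrib] using h3
  have hj := Finset.single_le_sum (f := fun j => Φ.form (y j - v j) (y j - v j))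
    (fun j _ => Φ.nonneg _) (Finset.mem_univ j)
  rw [← Φ.eq_of_form_sub_le (hj.trans hsum), hy]
  exact effect_nonneg (he j) hx

theorem sum_form_le (h1 : S.ClassicalDecomposability) (h2 : S.StrongSymmetry) {w : ι → A}
    (hw : S.IsFrame w) {x : A} (hx : x ∈ S.cone) : ∑ i, Φ.form (w i) x ≤ S.unit x := by
  classical
  obtain ⟨g, v, hv, h⟩ := Φ.exists_extension h2 hw
  rw [← Φ.form_sum, ← Φ.sum_eq h2 hv, map_sum, LinearMap.sum_apply]
  simp only [← h]
  rw [← Finset.sum_map Finset.univ g (fun i => Φ.form (v i) x)]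
  exact Finset.sum_le_sum_of_subset_of_nonneg (Finset.subset_univ _)
    fun i _ _ => Φ.form_frame_nonneg h1 h2 hv i hx

/-- Maximality under inclusion forces the largest size, because the extension of `w` to that size
adds nothing. -/
theorem exists_equiv_of_isMaximalFrame (h2 : S.StrongSymmetry) {w : ι → A}
    (hw : S.IsMaximalFrame w) : ∃ v : Fin Φ.size → A, S.IsFrame v ∧
      ∃ g : ι ≃ Fin Φ.size, ∀ i, v (g i) = w i := by
  obtain ⟨g, v, hv, h⟩ := Φ.exists_extension h2 hw.1
  have hr := hw.2 _ v hv (by rintro _ ⟨i, rfl⟩; exact ⟨g i, h i⟩)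
  refine ⟨v, hv, Equiv.ofBijective g ⟨g.injective, fun j => ?_⟩, h⟩
  obtain ⟨i, hi⟩ := hr.le ⟨j, rfl⟩
  exact ⟨i, hv.injective ((h i).trans hi)⟩

theorem sum_form_eq (h2 : S.StrongSymmetry) {w : ι → A} (hw : S.IsMaximalFrame w) (x : A) :
    ∑ i, Φ.form (w i) x = S.unit x := by
  obtain ⟨v, hv, g, h⟩ := Φ.exists_equiv_of_isMaximalFrame h2 hw
  rw [← Φ.form_sum, ← Φ.sum_eq h2 hv, map_sum, LinearMap.sum_apply,
    ← g.sum_comp (fun i => Φ.form (v i) x)]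
  simp only [h]

theorem isMaximalFrame {v : Fin Φ.size → A} (hv : S.IsFrame v) :
    S.IsMaximalFrame v := by
  refine ⟨hv, fun n w hw hr => Set.Subset.antisymm ?_ hr⟩
  have hfin := Set.finite_range w
  refine (Set.eq_of_subset_of_ncard_le hr ?_ hfin).ge
  rw [← Set.image_univ, ← Set.image_univ, Set.ncard_image_of_injective _ hw.injective,
    Set.ncard_image_of_injective _ hv.injective]
  simpa using Φ.le_size n w hw

end FrameForm

end DynamicalStateSpace

/-- Bijections chosen fibre by fibre are glued together. -/
theorem exists_equiv_of_card_fiber_eq {ι κ : Type*} [Fintype ι] [Fintype κ] {a : ι → ℝ}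
    {b : κ → ℝ} (h : ∀ t, Nat.card {i // a i = t} = Nat.card {k // b k = t}) :
    ∃ σ : ι ≃ κ, ∀ i, b (σ i) = a i := by
  let e : ∀ t, {i // a i = t} ≃ {k // b k = t} := fun t => (Finite.card_eq.1 (h t)).some
  refine ⟨(Equiv.sigmaFiberEquiv a).symm.trans
    ((Equiv.sigmaCongrRight e).trans (Equiv.sigmaFiberEquiv b)), fun i => ?_⟩
  exact (e (a i) ⟨i, rfl⟩).2

/-! ### Uniqueness of diagonal decompositions -/

namespace DynamicalStateSpace

variable {A : Type*} [NormedAddCommGroup A] [NormedSpace ℝ A] [FiniteDimensional ℝ A]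
  {S : DynamicalStateSpace A} {ι κ : Type*} [Fintype ι] [Fintype κ]

/-- Only orthonormality within each frame is used. The cross terms are completed to squares, and the
remainders carry the defects of the row and column sums from `1`. -/
theorem FrameForm.form_sub_self (Φ : S.FrameForm) (h2 : S.StrongSymmetry) {w : ι → A} {v : κ → A}
    (hw : S.IsFrame w) (hv : S.IsFrame v) (a : ι → ℝ) (b : κ → ℝ) :
    Φ.form (∑ i, a i • w i - ∑ k, b k • v k) (∑ i, a i • w i - ∑ k, b k • v k) =
      ∑ i, a i ^ 2 * (1 - ∑ k, Φ.form (w i) (v k)) +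
      ∑ k, b k ^ 2 * (1 - ∑ i, Φ.form (w i) (v k)) +
      ∑ i, ∑ k, Φ.form (w i) (v k) * (a i - b k) ^ 2 := by
  rw [map_sub Φ.form, LinearMap.sub_apply, map_sub, map_sub, Φ.form_self_sum h2 hw,
    Φ.form_self_sum h2 hv, Φ.comm (∑ k, b k • v k)]
  have hc : Φ.form (∑ i, a i • w i) (∑ k, b k • v k) =
      ∑ i, ∑ k, Φ.form (w i) (v k) * (a i * b k) := by
    simp only [map_sum, LinearMap.sum_apply, map_smul, LinearMap.smul_apply, smul_eq_mul]
    simp only [Finset.mul_sum]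
    rw [Finset.sum_comm]
    exact Finset.sum_congr rfl fun i _ => Finset.sum_congr rfl fun k _ => by ring
  have hr : ∑ i, ∑ k, Φ.form (w i) (v k) * (a i - b k) ^ 2 =
      ∑ i, a i ^ 2 * ∑ k, Φ.form (w i) (v k) + ∑ k, b k ^ 2 * ∑ i, Φ.form (w i) (v k) -
      2 * ∑ i, ∑ k, Φ.form (w i) (v k) * (a i * b k) := by
    simp only [Finset.mul_sum]
    rw [Finset.sum_comm (s := Finset.univ (α := κ)), ← Finset.sum_add_distrib,
      ← Finset.sum_sub_distrib]
    refine Finset.sum_congr rfl fun i _ => ?_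
    rw [← Finset.sum_add_distrib, ← Finset.sum_sub_distrib]
    exact Finset.sum_congr rfl fun k _ => by ring
  rw [hc, hr]
  simp only [mul_sub, mul_one, Finset.sum_sub_distrib, ← pow_two]
  ring

/-- A function of an element given by a diagonal decomposition does not depend on the
decomposition, provided that the frames are maximal or the function vanishes at zero. -/
theorem sum_apply_eq (h1 : S.ClassicalDecomposability) (h2 : S.StrongSymmetry) {w : ι → A}
    {v : κ → A} (hw : S.IsFrame w) (hv : S.IsFrame v) {a : ι → ℝ} {b : κ → ℝ}
    (h : ∑ i, a i • w i = ∑ k, b k • v k) (f : ℝ → ℝ)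
    (hf : f 0 = 0 ∨ S.IsMaximalFrame w ∧ S.IsMaximalFrame v) :
    ∑ i, f (a i) • w i = ∑ k, f (b k) • v k := by
  obtain ⟨Φ⟩ := nonempty_frameForm h1 h2
  have hD : ∀ i k, 0 ≤ Φ.form (w i) (v k) := fun i k =>
    Φ.form_frame_nonneg h1 h2 hw i (hv.mem_cone k)
  have hR : ∀ i, ∑ k, Φ.form (w i) (v k) ≤ 1 := fun i => by
    rw [← hw.unit_eq_one i]
    simpa only [Φ.comm (w i)] using Φ.sum_form_le h1 h2 hv (hw.mem_cone i)
  have hC : ∀ k, ∑ i, Φ.form (w i) (v k) ≤ 1 := fun k => by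
    rw [← hv.unit_eq_one k]
    exact Φ.sum_form_le h1 h2 hw (hv.mem_cone k)
  -- By `h` the left side is zero, so every nonnegative term on the right vanishes.
  have key := Φ.form_sub_self h2 hw hv a b
  rw [h, sub_self, map_zero] at key
  have n1 : ∀ i, 0 ≤ a i ^ 2 * (1 - ∑ k, Φ.form (w i) (v k)) := fun i =>
    mul_nonneg (sq_nonneg _) (sub_nonneg.2 (hR i))
  have n2 : ∀ k, 0 ≤ b k ^ 2 * (1 - ∑ i, Φ.form (w i) (v k)) := fun k =>
    mul_nonneg (sq_nonneg _) (sub_nonneg.2 (hC k))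
  have n3 : ∀ i k, 0 ≤ Φ.form (w i) (v k) * (a i - b k) ^ 2 := fun i k =>
    mul_nonneg (hD i k) (sq_nonneg _)
  have s1 := Finset.sum_nonneg fun i (_ : i ∈ Finset.univ) => n1 i
  have s2 := Finset.sum_nonneg fun k (_ : k ∈ Finset.univ) => n2 k
  have s3 := Finset.sum_nonneg fun i (_ : i ∈ Finset.univ) =>
    Finset.sum_nonneg fun k (_ : k ∈ Finset.univ) => n3 i k
  have z1 : ∀ i, a i ^ 2 * (1 - ∑ k, Φ.form (w i) (v k)) = 0 := fun i =>
    (Finset.sum_eq_zero_iff_of_nonneg fun i _ => n1 i).1 (by linarith) i (Finset.mem_univ i)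
  have z2 : ∀ k, b k ^ 2 * (1 - ∑ i, Φ.form (w i) (v k)) = 0 := fun k =>
    (Finset.sum_eq_zero_iff_of_nonneg fun k _ => n2 k).1 (by linarith) k (Finset.mem_univ k)
  have z3 : ∀ i k, Φ.form (w i) (v k) * (a i - b k) ^ 2 = 0 := fun i k =>
    (Finset.sum_eq_zero_iff_of_nonneg fun k _ => n3 i k).1
      ((Finset.sum_eq_zero_iff_of_nonneg fun i _ => Finset.sum_nonneg fun k _ => n3 i k).1
        (by linarith) i (Finset.mem_univ i)) k (Finset.mem_univ k)
  -- A row with positive defect has `a i = 0`, where `f 0 = 0` helps; if `v` is maximal no row has a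
  -- defect.
  have y1 : ∀ i, f (a i) ^ 2 * (1 - ∑ k, Φ.form (w i) (v k)) = 0 := fun i => by
    rcases mul_eq_zero.1 (z1 i) with ha | ha
    · rcases hf with hf | hf
      · simp [pow_eq_zero_iff two_ne_zero |>.1 ha, hf]
      · have := Φ.sum_form_eq h2 hf.2 (w i)
        simp only [Φ.comm _ (w i), hw.unit_eq_one] at this
        rw [this, sub_self, mul_zero]
    · rw [ha, mul_zero]
  have y2 : ∀ k, f (b k) ^ 2 * (1 - ∑ i, Φ.form (w i) (v k)) = 0 := fun k => by
    rcases mul_eq_zero.1 (z2 k) with hb | hb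
    · rcases hf with hf | hf
      · simp [pow_eq_zero_iff two_ne_zero |>.1 hb, hf]
      · rw [Φ.sum_form_eq h2 hf.1, hv.unit_eq_one, sub_self, mul_zero]
    · rw [hb, mul_zero]
  have y3 : ∀ i k, Φ.form (w i) (v k) * (f (a i) - f (b k)) ^ 2 = 0 := fun i k => by
    rcases mul_eq_zero.1 (z3 i k) with hd | hd
    · rw [hd, zero_mul]
    · rw [sub_eq_zero.1 (pow_eq_zero_iff two_ne_zero |>.1 hd), sub_self, zero_pow two_ne_zero,
        mul_zero]
  refine Φ.eq_of_form_sub_le (le_of_eq ?_)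
  rw [Φ.form_sub_self h2 hw hv (fun i => f (a i)) (fun k => f (b k))]
  simp only [y1, y2, y3, Finset.sum_const_zero, add_zero]

/-- Take `f` to be the indicator of `t`, which vanishes at `0` when `t ≠ 0`; the unit then counts
the fibre. -/
theorem card_fiber_eq (h1 : S.ClassicalDecomposability) (h2 : S.StrongSymmetry) {w : ι → A}
    {v : κ → A} (hw : S.IsFrame w) (hv : S.IsFrame v) {a : ι → ℝ} {b : κ → ℝ}
    (h : ∑ i, a i • w i = ∑ k, b k • v k) (t : ℝ)
    (ht : t ≠ 0 ∨ S.IsMaximalFrame w ∧ S.IsMaximalFrame v) :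
    Nat.card {i // a i = t} = Nat.card {k // b k = t} := by
  classical
  have := congrArg S.unit (sum_apply_eq h1 h2 hw hv h (fun s => if s = t then 1 else 0)
    (ht.imp_left fun ht => by simp [ht.symm]))
  simp only [map_sum, map_smul, hw.unit_eq_one, hv.unit_eq_one, smul_eq_mul, mul_one,
    Finset.sum_boole, Nat.cast_inj] at this
  rw [Nat.card_eq_fintype_card, Nat.card_eq_fintype_card, Fintype.card_subtype,
    Fintype.card_subtype, this]

theorem exists_isMaximalFrame_decomposition (h1 : S.ClassicalDecomposability)
    (h2 : S.StrongSymmetry) {w : A} (hw : w ∈ S.states) :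
    ∃ (n : ℕ) (p : Fin n → ℝ) (v : Fin n → A),
      S.IsClassicalDecomposition w p v ∧ S.IsMaximalFrame v := by
  obtain ⟨Φ⟩ := nonempty_frameForm h1 h2
  obtain ⟨p, v, hp, hv, hwv⟩ := Φ.exists_diagonal_of_mem_cone h1 h2 (S.states_subset_cone hw)
  refine ⟨_, p, v, ⟨hp, ?_, hv, hwv⟩, Φ.isMaximalFrame hv⟩
  have := congrArg S.unit hwv
  simpa [AbstractStateSpace.unit_eq_one hw, hv.unit_eq_one] using this.symm

/-! ### Eigenvalues, eigenface units and eigenfaces -/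

namespace ObservableDecomposition

variable {𝒜 : A}

theorem apply_eq_sum_sigma (D : S.ObservableDecomposition 𝒜) (f : ℝ → ℝ) :
    D.apply f = ∑ i : (x : Fin D.n) × Fin (D.mult x), f (D.a i.1) • D.w i.1 i.2 := by
  rw [Fintype.sum_sigma]
  simp only [apply, Finset.smul_sum]

theorem eq_sum_sigma (D : S.ObservableDecomposition 𝒜) :
    𝒜 = ∑ i : (x : Fin D.n) × Fin (D.mult x), D.a i.1 • D.w i.1 i.2 :=
  D.eq_sum.trans (D.apply_eq_sum_sigma id)

theorem apply_eq (h1 : S.ClassicalDecomposability) (h2 : S.StrongSymmetry)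
    (D D' : S.ObservableDecomposition 𝒜) (f : ℝ → ℝ) : D.apply f = D'.apply f := by
  rw [apply_eq_sum_sigma, apply_eq_sum_sigma]
  exact sum_apply_eq h1 h2 D.maximal.1 D'.maximal.1 (D.eq_sum_sigma.symm.trans D'.eq_sum_sigma) f
    (Or.inr ⟨D.maximal, D'.maximal⟩)

theorem unit_faceUnit (D : S.ObservableDecomposition 𝒜) (x : Fin D.n) :
    S.unit (D.faceUnit x) = D.mult x := by
  have : ∀ j, S.unit (D.w x j) = 1 := fun j => D.maximal.1.unit_eq_one ⟨x, j⟩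
  simp [faceUnit, this]

/-- This exhibits the eigenface unit as a function of the observable and its eigenvalue alone. -/
theorem apply_ite (D : S.ObservableDecomposition 𝒜) (x : Fin D.n) :
    D.apply (fun s => if s = D.a x then 1 else 0) = D.faceUnit x := by
  simp [apply, faceUnit, D.injective_a.eq_iff]

theorem faceGenerated_faceUnit (D : S.ObservableDecomposition 𝒜) (x : Fin D.n) :
    faceGenerated S.cone {D.faceUnit x} = D.eigenface x := by
  have : Nonempty (Fin (D.mult x)) := ⟨⟨0, D.mult_pos x⟩⟩
  exact (AbstractStateSpace.faceGenerated_range fun j => D.maximal.1.mem_cone ⟨x, j⟩).symm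

/-- Were `D.a x` missing from `D'`, its indicator would give zero, whereas the unit of `D.faceUnit
x` is the positive multiplicity. -/
theorem range_a_subset (h1 : S.ClassicalDecomposability) (h2 : S.StrongSymmetry)
    (D D' : S.ObservableDecomposition 𝒜) : Set.range D.a ⊆ Set.range D'.a := by
  rintro _ ⟨x, rfl⟩
  by_contra h
  have hx := D.apply_ite x
  rw [apply_eq h1 h2 D D', apply, Finset.sum_eq_zero] at hx
  · have := D.unit_faceUnit x
    rw [← hx, map_zero] at this
    exact (D.mult_pos x).ne (by exact_mod_cast this)
  · intro y _
    rw [if_neg fun hy => h ⟨y, hy⟩, zero_smul]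

theorem exists_equiv (h1 : S.ClassicalDecomposability) (h2 : S.StrongSymmetry)
    (D D' : S.ObservableDecomposition 𝒜) : ∃ σ : Fin D.n ≃ Fin D'.n, ∀ x,
      D'.a (σ x) = D.a x ∧ D'.faceUnit (σ x) = D.faceUnit x ∧ D'.mult (σ x) = D.mult x ∧
      D'.eigenface (σ x) = D.eigenface x := by
  have hr : Set.range D.a = Set.range D'.a :=
    (range_a_subset h1 h2 D D').antisymm (range_a_subset h1 h2 D' D)
  -- Match indices with equal eigenvalue.
  let σ : Fin D.n ≃ Fin D'.n := (Equiv.ofInjective _ D.injective_a).trans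
    ((Equiv.setCongr hr).trans (Equiv.ofInjective _ D'.injective_a).symm)
  have ha : ∀ x, D'.a (σ x) = D.a x := fun x => by
    simp only [σ, Equiv.trans_apply, Equiv.apply_ofInjective_symm]
    rfl
  refine ⟨σ, fun x => ?_⟩
  have hu : D'.faceUnit (σ x) = D.faceUnit x := by
    rw [← apply_ite, ← apply_ite, ha, apply_eq h1 h2 D D']
  refine ⟨ha x, hu, ?_, ?_⟩
  · have := D'.unit_faceUnit (σ x)
    rw [hu, unit_faceUnit] at this
    exact_mod_cast this.symm
  · rw [← faceGenerated_faceUnit, ← faceGenerated_faceUnit, hu]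

end ObservableDecomposition

end DynamicalStateSpace
end GPT
end

theorem mainTheorem7 {A : Type*} [NormedAddCommGroup A] [NormedSpace ℝ A] [FiniteDimensional ℝ A]
    (S : GPT.DynamicalStateSpace A) (h1 : S.ClassicalDecomposability) (h2 : S.StrongSymmetry) :
    -- eigenvalues, eigenface units, multiplicities and eigenfaces of an observable
    (∀ (𝒜 : A) (D D' : S.ObservableDecomposition 𝒜),
      D.n = D'.n ∧
      ∃ σ : Fin D.n ≃ Fin D'.n, ∀ x,
        D'.a (σ x) = D.a x ∧ D'.faceUnit (σ x) = D.faceUnit x ∧ D'.mult (σ x) = D.mult x ∧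
        D'.eigenface (σ x) = D.eigenface x ∧
        GPT.faceGenerated S.cone {D.faceUnit x} = D.eigenface x) ∧
    -- the non-zero probabilities in a classical decomposition of a state
    (∀ (w : A) (n n' : ℕ) (p : Fin n → ℝ) (p' : Fin n' → ℝ) (v : Fin n → A) (v' : Fin n' → A),
      S.IsClassicalDecomposition w p v → S.IsClassicalDecomposition w p' v' →
      ∃ σ : {j // p j ≠ 0} ≃ {j // p' j ≠ 0}, ∀ j, p' (σ j) = p j) ∧
    -- all probabilities, for maximal frames
    (∀ (w : A) (n n' : ℕ) (p : Fin n → ℝ) (p' : Fin n' → ℝ) (v : Fin n → A) (v' : Fin n' → A),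
      S.IsClassicalDecomposition w p v → S.IsMaximalFrame v →
      S.IsClassicalDecomposition w p' v' → S.IsMaximalFrame v' →
      ∃ σ : Fin n ≃ Fin n', ∀ j, p' (σ j) = p j) ∧
    -- the logarithm of a state, with an arbitrary convention for the logarithm of zero
    (∀ ln : ℝ → ℝ, (∀ t, 0 < t → ln t = Real.log t) →
      ∀ w ∈ S.states,
        (∃ (n : ℕ) (p : Fin n → ℝ) (v : Fin n → A),
          S.IsClassicalDecomposition w p v ∧ S.IsMaximalFrame v) ∧
        ∃ L : A,
          (∀ (n : ℕ) (p : Fin n → ℝ) (v : Fin n → A),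
            S.IsClassicalDecomposition w p v → S.IsMaximalFrame v → ∑ j, ln (p j) • v j = L) ∧
          ∀ D : S.ObservableDecomposition w, D.apply ln = L) ∧
    -- functions of observables
    (∀ (f : ℝ → ℝ) (𝒜 : A) (D D' : S.ObservableDecomposition 𝒜), D.apply f = D'.apply f) := by
  refine ⟨fun 𝒜 D D' => ?_, fun w n n' p p' v v' hd hd' => ?_,
    fun w n n' p p' v v' hd hv hd' hv' => ?_, fun ln _ w hw => ?_,
    fun f 𝒜 D D' => D.apply_eq h1 h2 D' f⟩
  · obtain ⟨σ, hσ⟩ := D.exists_equiv h1 h2 D'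
    refine ⟨by simpa using Fintype.card_congr σ, σ, fun x => ?_⟩
    exact ⟨(hσ x).1, (hσ x).2.1, (hσ x).2.2.1, (hσ x).2.2.2, D.faceGenerated_faceUnit x⟩
  · refine GPT.exists_equiv_of_card_fiber_eq (a := fun j : {j // p j ≠ 0} => p j)
      (b := fun j : {j // p' j ≠ 0} => p' j) fun t => ?_
    by_cases ht : t = 0
    · have e1 : IsEmpty {j : {j // p j ≠ 0} // p j = t} := ⟨fun j => j.1.2 (j.2.trans ht)⟩
      have e2 : IsEmpty {j : {j // p' j ≠ 0} // p' j = t} := ⟨fun j => j.1.2 (j.2.trans ht)⟩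
      rw [Nat.card_of_isEmpty, Nat.card_of_isEmpty]
    · have hc := GPT.DynamicalStateSpace.card_fiber_eq h1 h2 hd.2.2.1 hd'.2.2.1
        (hd.2.2.2.symm.trans hd'.2.2.2) t (Or.inl ht)
      -- For `t ≠ 0`, restricting to nonzero probabilities leaves the fibre over `t` unchanged.
      rwa [← Nat.card_congr (Equiv.subtypeSubtypeEquivSubtype (p := (p · ≠ 0)) (q := (p · = t))
          fun {_} h => h.trans_ne ht),
        ← Nat.card_congr (Equiv.subtypeSubtypeEquivSubtype (p := (p' · ≠ 0)) (q := (p' · = t))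
          fun {_} h => h.trans_ne ht)] at hc
  · exact GPT.exists_equiv_of_card_fiber_eq fun t => GPT.DynamicalStateSpace.card_fiber_eq h1 h2
      hd.2.2.1 hd'.2.2.1 (hd.2.2.2.symm.trans hd'.2.2.2) t (Or.inr ⟨hv, hv'⟩)
  · obtain ⟨m, q, u, hq, hu⟩ :=
      GPT.DynamicalStateSpace.exists_isMaximalFrame_decomposition h1 h2 hw
    refine ⟨⟨m, q, u, hq, hu⟩, ∑ j, ln (q j) • u j, fun n p v hd hv => ?_, fun D => ?_⟩
    · exact GPT.DynamicalStateSpace.sum_apply_eq h1 h2 hv.1 hu.1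
        (hd.2.2.2.symm.trans hq.2.2.2) ln (Or.inr ⟨hv, hu⟩)
    · rw [D.apply_eq_sum_sigma]
      exact GPT.DynamicalStateSpace.sum_apply_eq h1 h2 D.maximal.1 hu.1
        (D.eq_sum_sigma.symm.trans hq.2.2.2) ln (Or.inr ⟨D.maximal, hu⟩)
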